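/- Let $D=\{(x,y)\in\mathbb{R}^2 : x>0\}$. Let $\alpha_1=1$ and $2(k+1)(4k^2+\tfrac54)\alpha_{k+1}+(2k-1)\alpha_k=0$ for $k\ge 1$, and put $$X_0(x)=\tfrac52+\sum_{k\ge1}\alpha_kx^{2k}\quad (x\in\mathbb{R}),\qquad h(x,y)=2X_0-xX_0'+y^2\,\frac{X_0'}{x}+\sqrt5 .$$ On $D$ define $$a_1(x,y)=\tfrac{2y}{xh}\left(X_0+\tfrac{\sqrt5}{2}\right),\quad b_1(x,y)=-\tfrac{1}{xh}\left(X_0+\tfrac{\sqrt5}{2}+\sqrt5(x^2-y^2)\right),\quad c_1(x,y)=-\tfrac{2}{xh}\left(X_0+\tfrac{\sqrt5}{2}\right),$$ $$a_2(x,y)=-\tfrac1h\left(2X_0+\sqrt5-(x^2+y^2)\tfrac{X_0'}{x}\right),\quad b_2(x,y)=-\tfrac{2y}{h}\left(\tfrac{X_0'}{2x}+\sqrt5\right),\quad c_2(x,y)=\tfrac{2y}{h}\left(X_0''-\tfrac{X_0'}{x}\right).$$ A frame field on $D$ is an analytic orthonormal frame field $F^0=[\phi,X_\alpha^0,X_\beta^0,\xi]$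 of $\mathbb{R}^4$ along $D$ satisfying $dF^0=F^0(\Omega_1dx+\Omega_2dy)$, that is, $$\phi_x=-a_1X^0_\alpha,\quad \xi_x=b_1X^0_\alpha,\quad (X^0_\beta)_x=c_1X^0_\alpha,\quad (X^0_\alpha)_x=a_1\phi-b_1\xi-c_1X^0_\beta,$$ $$\phi_y=-a_2X^0_\beta,\quad \xi_y=b_2X^0_\beta,\quad (X^0_\alpha)_y=c_2X^0_\beta,\quad (X^0_\beta)_y=a_2\phi-b_2\xi-c_2X^0_\alpha .$$ A curvature surface on $D$ determined by $F^0$ is an analytic map $f^0:D\to\mathbb{R}^4$ with $$df^0=\frac{x^2-y^2}{xh}\,X^0_\alpha\,dx+\frac{2y}{h}\,X^0_\beta\,dy .$$ Let $f^0$ be a curvature surface on $D$ determined by a frame field $F^0$. Then there are uniquely determined functions $u,v_1,A:\mathbb{R}\to\mathbb{R}^4$, with $u$ and $A$ analytic and $v_1$ continuous with $\|v_1\|=1$, such that for all $x>0$ and $y\in\mathbb{R}$ $$u(y)=\frac{(yX^0_\beta-\phi)(x,y)}{\sqrt{1+y^2}},\qquad \frac{du}{dy}(y)=\frac{y^2}{1+y^2}\,v_1(y),$$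 $$f^0(x,y)=\frac{1}{2\sqrt5}\sqrt{\frac{5+4y^2}{1+y^2}}\;\frac{\left(X^0_\beta-2(1+y^2)\xi+y\phi\right)(x,y)}{\sqrt{(1+y^2)(5+4y^2)}}+A(y).$$ Moreover, for every sequence $(x_n,y_n)$ in $D$ that converges to $(0,0)$ in $\mathbb{R}^2$, $$f^0(x_n,y_n)\longrightarrow -\tfrac12 v_1(0)+A(0).$$ Hence, setting $f^0(0,0):=-\tfrac12 v_1(0)+A(0)$ extends $f^0$ to a continuous map on $D\cup\{(0,0)\}$. -/

import Mathlib

noncomputable section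

namespace CurvatureSurface

/-- Euclidean four-space. -/
abbrev E4 : Type := EuclideanSpace ℝ (Fin 4)

/-- The half plane `{(x, y) | x > 0}`. -/
def D : Set (ℝ × ℝ) := {p | 0 < p.1}

/-- The coefficients `a_k`, `k ≥ 1`, of the hypergeometric series; the value at `0` is set to `0`. -/
def coeff : ℕ → ℝ
  | 0 => 0
  | 1 => 1
  | k + 2 => -((2 * ((k : ℝ) + 1) - 1) * coeff (k + 1)) /
      (2 * (((k : ℝ) + 1) + 1) * (4 * ((k : ℝ) + 1) ^ 2 + 5 / 4))

/-- The defining recursion `a_1 = 1`, `2(k+1)(4k²+5/4) a_{k+1} + (2k-1) a_k = 0` for `k ≥ 1`. -/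
theorem coeff_rec : coeff 1 = 1 ∧ ∀ k : ℕ, 1 ≤ k →
    2 * ((k : ℝ) + 1) * (4 * (k : ℝ) ^ 2 + 5 / 4) * coeff (k + 1)
      + (2 * (k : ℝ) - 1) * coeff k = 0 := by
  refine ⟨rfl, ?_⟩
  intro k hk
  obtain ⟨m, rfl⟩ : ∃ m, k = m + 1 := ⟨k - 1, by omega⟩
  have h1 : (2 * (((m : ℝ) + 1) + 1) * (4 * ((m : ℝ) + 1) ^ 2 + 5 / 4)) ≠ 0 := by positivity
  have h2 : coeff (m + 1 + 1) = -((2 * ((m : ℝ) + 1) - 1) * coeff (m + 1)) /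
      (2 * (((m : ℝ) + 1) + 1) * (4 * ((m : ℝ) + 1) ^ 2 + 5 / 4)) := by
    rw [coeff]
  rw [h2]
  push_cast
  field_simp
  ring

/-- `X₀(x) = 5/2 + ∑_{k ≥ 1} a_k x^{2k}`. -/
def X0 (x : ℝ) : ℝ := 5 / 2 + ∑' k : ℕ, coeff (k + 1) * x ^ (2 * (k + 1))

/-- The series defining `X₀` converges for every real `x`. -/
theorem summable_X0 (x : ℝ) : Summable fun k : ℕ => coeff (k + 1) * x ^ (2 * (k + 1)) := by
  have key : ∀ k : ℕ, ‖coeff (k + 2) * x ^ (2 * (k + 2))‖ ≤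
      (x ^ 2 / ((k : ℝ) + 1)) * ‖coeff (k + 1) * x ^ (2 * (k + 1))‖ := by
    intro k
    have hk : (0 : ℝ) ≤ k := Nat.cast_nonneg k
    have hpow : x ^ (2 * (k + 2)) = x ^ 2 * x ^ (2 * (k + 1)) := by ring
    have hden : (0 : ℝ) < 2 * (((k : ℝ) + 1) + 1) * (4 * ((k : ℝ) + 1) ^ 2 + 5 / 4) := by
      positivity
    have hnum : (0 : ℝ) ≤ 2 * ((k : ℝ) + 1) - 1 := by linarith
    have hc : |coeff (k + 2)| ≤ |coeff (k + 1)| / ((k : ℝ) + 1) := by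
      rw [coeff, abs_div, abs_neg, abs_mul, abs_of_nonneg hnum, abs_of_pos hden,
        div_le_div_iff₀ hden (by linarith)]
      have : (2 * ((k : ℝ) + 1) - 1) * ((k : ℝ) + 1) ≤
          2 * (((k : ℝ) + 1) + 1) * (4 * ((k : ℝ) + 1) ^ 2 + 5 / 4) := by
        nlinarith [pow_nonneg hk 2, pow_nonneg hk 3]
      nlinarith [abs_nonneg (coeff (k + 1))]
    rw [hpow, norm_mul, norm_mul, norm_mul, Real.norm_eq_abs, Real.norm_eq_abs (x ^ 2),
      Real.norm_eq_abs (coeff (k + 1)), abs_of_nonneg (sq_nonneg x)]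
    calc |coeff (k + 2)| * (x ^ 2 * ‖x ^ (2 * (k + 1))‖)
        ≤ |coeff (k + 1)| / ((k : ℝ) + 1) * (x ^ 2 * ‖x ^ (2 * (k + 1))‖) := by gcongr
      _ = _ := by ring
  refine summable_of_ratio_norm_eventually_le (r := 1 / 2) (by norm_num) ?_
  obtain ⟨N, hN⟩ := exists_nat_gt (2 * x ^ 2)
  filter_upwards [Filter.eventually_ge_atTop N] with k hkN
  refine (key k).trans (mul_le_mul_of_nonneg_right ?_ (norm_nonneg _))
  have : (N : ℝ) ≤ k := by exact_mod_cast hkN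
  have hk : (0 : ℝ) ≤ k := Nat.cast_nonneg k
  rw [div_le_div_iff₀ (by linarith) (by norm_num)]
  linarith

/-- The first derivative of `X₀`. -/
def dX0 (x : ℝ) : ℝ := deriv X0 x

/-- The second derivative of `X₀`. -/
def ddX0 (x : ℝ) : ℝ := deriv (deriv X0) x

/-- `h(x, y) = 2 X₀ - x X₀' + y² (X₀'/x) + √5`, used for `x > 0`. -/
def h (p : ℝ × ℝ) : ℝ :=
  2 * X0 p.1 - p.1 * dX0 p.1 + p.2 ^ 2 * (dX0 p.1 / p.1) + √5

def a₁ (p : ℝ × ℝ) : ℝ := 2 * p.2 / (p.1 * h p) * (X0 p.1 + √5 / 2)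

def b₁ (p : ℝ × ℝ) : ℝ :=
  -1 / (p.1 * h p) * (X0 p.1 + √5 / 2 + √5 * (p.1 ^ 2 - p.2 ^ 2))

def c₁ (p : ℝ × ℝ) : ℝ := -2 / (p.1 * h p) * (X0 p.1 + √5 / 2)

def a₂ (p : ℝ × ℝ) : ℝ :=
  -1 / h p * (2 * X0 p.1 + √5 - (p.1 ^ 2 + p.2 ^ 2) * (dX0 p.1 / p.1))

def b₂ (p : ℝ × ℝ) : ℝ := -2 * p.2 / h p * (dX0 p.1 / (2 * p.1) + √5)

def c₂ (p : ℝ × ℝ) : ℝ := 2 * p.2 / h p * (ddX0 p.1 - dX0 p.1 / p.1)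

/-- The `dx`-part of the connection form. -/
def Ω₁ (p : ℝ × ℝ) : Matrix (Fin 4) (Fin 4) ℝ :=
  !![0, a₁ p, 0, 0;
     -a₁ p, 0, c₁ p, b₁ p;
     0, -c₁ p, 0, 0;
     0, -b₁ p, 0, 0]

/-- The `dy`-part of the connection form. -/
def Ω₂ (p : ℝ × ℝ) : Matrix (Fin 4) (Fin 4) ℝ :=
  !![0, 0, a₂ p, 0;
     0, 0, -c₂ p, 0;
     -a₂ p, c₂ p, 0, b₂ p;
     0, 0, -b₂ p, 0]

/-- The linear map `v dx + w dy` from the plane to four-space. -/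
def form (v w : E4) : ℝ × ℝ →L[ℝ] E4 :=
  (ContinuousLinearMap.fst ℝ ℝ ℝ).smulRight v + (ContinuousLinearMap.snd ℝ ℝ ℝ).smulRight w

/-- Four vector fields `F 0 = φ`, `F 1 = X_α`, `F 2 = X_β`, `F 3 = ξ` along `D`, viewed as the
columns of a matrix `F`, form an analytic orthonormal frame field on `D` with
`dF = F (Ω₁ dx + Ω₂ dy)`. -/
structure IsFrameField (F : Fin 4 → ℝ × ℝ → E4) : Prop where
  analytic : ∀ j, AnalyticOnNhd ℝ (F j) D
  orthonormal : ∀ p ∈ D, Orthonormal ℝ fun j => F j p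
  structure_eq : ∀ p ∈ D, ∀ j,
    HasFDerivAt (F j) (form (∑ i, Ω₁ p i j • F i p) (∑ i, Ω₂ p i j • F i p)) p

/-- `f` is a curvature surface on `D` determined by the frame field `F`:
`df = (x² - y²)/(x h) X_α dx + (2y/h) X_β dy`. -/
structure IsCurvatureSurface (F : Fin 4 → ℝ × ℝ → E4) (f : ℝ × ℝ → E4) : Prop where
  frame : IsFrameField F
  analytic : AnalyticOnNhd ℝ f D
  integral : ∀ p ∈ D,
    HasFDerivAt f (form (((p.1 ^ 2 - p.2 ^ 2) / (p.1 * h p)) • F 1 p) ((2 * p.2 / h p) • F 2 p)) p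

/-- The vector `(1 + y²)^{-1/2} (y X_β - φ)`. -/
def axisVector (F : Fin 4 → ℝ × ℝ → E4) (p : ℝ × ℝ) : E4 :=
  (√(1 + p.2 ^ 2))⁻¹ • (p.2 • F 2 p - F 0 p)

/-- The vector `((1 + y²)(5 + 4y²))^{-1/2} (X_β - 2(1 + y²) ξ + y φ)`, the unit vector from the
centre of the sphere containing an `x`-curve to the point of that curve. -/
def sphereVector (F : Fin 4 → ℝ × ℝ → E4) (p : ℝ × ℝ) : E4 :=
  (√((1 + p.2 ^ 2) * (5 + 4 * p.2 ^ 2)))⁻¹ •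
    (F 2 p - (2 * (1 + p.2 ^ 2)) • F 3 p + p.2 • F 0 p)

/-- The radius `(2√5)^{-1} √((5 + 4y²)/(1 + y²))` of the sphere containing an `x`-curve. -/
def sphereRadius (y : ℝ) : ℝ := (2 * √5)⁻¹ * √((5 + 4 * y ^ 2) / (1 + y ^ 2))

/-- The functions `u`, `v₁`, `A` of `y` attached to a curvature surface. The derivative of `u`
vanishes at `0`, so the value `v₁ 0` is fixed through the continuity of `v₁`. -/
structure IsAssociated (F : Fin 4 → ℝ × ℝ → E4) (f : ℝ × ℝ → E4) (u v₁ A : ℝ → E4) : Prop where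
  u_eq : ∀ x y : ℝ, 0 < x → u y = axisVector F (x, y)
  u_analytic : AnalyticOnNhd ℝ u Set.univ
  v₁_unit : ∀ y, ‖v₁ y‖ = 1
  v₁_continuous : Continuous v₁
  u_deriv : ∀ y, HasDerivAt u ((y ^ 2 / (1 + y ^ 2)) • v₁ y) y
  surface_eq : ∀ x y : ℝ, 0 < x → f (x, y) = sphereRadius y • sphereVector F (x, y) + A y
  A_analytic : AnalyticOnNhd ℝ A Set.univ

end CurvatureSurface

end

/-! In `t = x²`, `X₀` is an entire function `G` solving a third-order linear equation. That equation
has a quadratic first integral, which carries the proof. It forces `G' > 0` and `G - tG' > 0` for `t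
≥ 0`, so `h` stays positive up to `x = 0`. It also says exactly that the vector `direction`, read
off from `du/dy`, has length 1 (`dir_coeff_sq`).

Along an `x`-curve, `u` and `f - radial` are constant because the `X_α`-components of their
derivatives cancel; this yields `u` and `A`. Differentiating `u` in `y` identifies `v₁` with
`direction` at every `x > 0`.

The frame need not converge at the corner, since the `dx`-part of the connection blows up like
`1/x`. But the frame coefficients of `radial` and `direction` extend continuously to the corner,
where they are `(0, 0, 1, -2)/(2√5)` and `(0, 0, -1, 2)/√5`. As the frame is bounded, `radial +
v₁(y)/2` tends to 0, which gives the limit of `f`. -/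

noncomputable section
namespace CurvatureSurface
open Filter Topology

/-! ### Termwise differentiation of entire power series -/

/-- The termwise derivative of an entire power series. -/
theorem powerSeries_hasDerivAt (c : ℕ → ℝ) (hc : ∀ r : ℝ, Summable fun k => c k * r ^ k) :
    (∀ r : ℝ, Summable fun k : ℕ => ((k : ℝ) + 1) * c (k + 1) * r ^ k) ∧
    ∀ t : ℝ, HasDerivAt (fun s => ∑' k : ℕ, c k * s ^ k)
      (∑' k : ℕ, ((k : ℝ) + 1) * c (k + 1) * t ^ k) t := by
  have hbound : ∀ r : ℝ, 1 ≤ r → Summable fun k : ℕ => (k : ℝ) * |c k| * r ^ (k - 1) := by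
    intro r hr
    -- Doubling the radius absorbs the factor `k ≤ 2 ^ k`.
    refine Summable.of_nonneg_of_le (fun k => by positivity) (fun k => ?_) (hc (2 * r)).abs
    have h1 : (k : ℝ) ≤ 2 ^ k := by exact_mod_cast Nat.lt_two_pow_self.le
    have h2 : r ^ (k - 1) ≤ r ^ k := pow_le_pow_right₀ hr (Nat.sub_le k 1)
    rw [abs_mul, abs_of_nonneg (by positivity : 0 ≤ (2 * r) ^ k), mul_pow]
    calc (k : ℝ) * |c k| * r ^ (k - 1) ≤ 2 ^ k * |c k| * r ^ k := by gcongr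
      _ = _ := by ring
  have hle : ∀ r t : ℝ, |t| ≤ r → ∀ k : ℕ,
      ‖c k * ((k : ℝ) * t ^ (k - 1))‖ ≤ (k : ℝ) * |c k| * r ^ (k - 1) := by
    intro r t ht k
    rw [norm_mul, norm_mul, norm_pow, Real.norm_eq_abs, Real.norm_eq_abs, Real.norm_eq_abs,
      abs_of_nonneg (Nat.cast_nonneg k : (0 : ℝ) ≤ k)]
    calc |c k| * ((k : ℝ) * |t| ^ (k - 1)) ≤ |c k| * ((k : ℝ) * r ^ (k - 1)) := by gcongr
      _ = _ := by ring
  have hs : ∀ t : ℝ, Summable fun k : ℕ => c k * ((k : ℝ) * t ^ (k - 1)) := fun t =>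
    Summable.of_norm_bounded (hbound (|t| + 1) (by linarith [abs_nonneg t]))
      (hle (|t| + 1) t (by linarith))
  have hshift : ∀ (t : ℝ) (k : ℕ), c (k + 1) * (((k + 1 : ℕ) : ℝ) * t ^ (k + 1 - 1)) =
      ((k : ℝ) + 1) * c (k + 1) * t ^ k := by
    intro t k
    rw [Nat.add_sub_cancel]; push_cast; ring
  refine ⟨fun r => ?_, fun t => ?_⟩
  · have := (summable_nat_add_iff 1).2 (hs r)
    simpa only [hshift] using this
  · have hd := hasDerivAt_tsum_of_isPreconnected (t := Metric.ball (0 : ℝ) (|t| + 1))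
      (g := fun k s => c k * s ^ k) (g' := fun k s => c k * ((k : ℝ) * s ^ (k - 1)))
      (y₀ := 0) (y := t)
      (hbound (|t| + 1) (by linarith [abs_nonneg t])) Metric.isOpen_ball
      (convex_ball _ _).isPreconnected
      (fun k s _ => (hasDerivAt_pow k s).const_mul (c k))
      (fun k s hsm => hle _ s (by simpa using (Metric.mem_ball.1 hsm).le) k)
      (Metric.mem_ball_self (by positivity)) (hc 0) (by simp)
    rw [(hs t).tsum_eq_zero_add] at hd
    simpa only [hshift, Nat.cast_zero, zero_mul, mul_zero, zero_add] using hd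

/-- Multiplying a power series by its variable. -/
theorem hasSum_mul_shift (d : ℕ → ℝ) (t : ℝ) (e : ℕ → ℝ) (h0 : e 0 = 0)
    (he : ∀ k, e (k + 1) = d k) (hd : Summable fun k => d k * t ^ k) :
    HasSum (fun k => e k * t ^ k) (t * ∑' k, d k * t ^ k) := by
  rw [← hasSum_nat_add_iff' 1]
  simp only [Finset.range_one, Finset.sum_singleton, h0, zero_mul, sub_zero, he]
  exact (hd.hasSum.mul_left t).congr_fun fun k => by ring

/-! ### The hypergeometric equation and its first integral -/

/-- The coefficients of `X₀` as a power series in `x²`. -/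
def coeffSq (k : ℕ) : ℝ := if k = 0 then 5 / 2 else coeff k

theorem coeffSq_rec (k : ℕ) :
    2 * ((k : ℝ) + 1) * (4 * (k : ℝ) ^ 2 + 5 / 4) * coeffSq (k + 1)
      + (2 * (k : ℝ) - 1) * coeffSq k = 0 := by
  rcases Nat.eq_zero_or_pos k with rfl | hk
  · have := coeff_rec.1
    norm_num [coeffSq, this]
  · simpa [coeffSq, hk.ne'] using coeff_rec.2 k hk

theorem summable_coeffSq (r : ℝ) : Summable fun k => coeffSq k * r ^ k := by
  rw [← summable_nat_add_iff 1]
  refine Summable.of_norm ((summable_X0 √|r|).norm.congr fun k => ?_)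
  rw [pow_mul, Real.sq_sqrt (abs_nonneg r)]
  simp [coeffSq]

/-- `X₀` as a function of `t = x²`. -/
def G (t : ℝ) : ℝ := ∑' k, coeffSq k * t ^ k

/-- The derivative of `G`. -/
def G₁ (t : ℝ) : ℝ := ∑' k : ℕ, ((k : ℝ) + 1) * coeffSq (k + 1) * t ^ k

/-- The second derivative of `G`. -/
def G₂ (t : ℝ) : ℝ :=
  ∑' k : ℕ, ((k : ℝ) + 1) * (((k + 1 : ℕ) + 1) * coeffSq (k + 1 + 1)) * t ^ k

/-- The third derivative of `G`. -/
def G₃ (t : ℝ) : ℝ :=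
  ∑' k : ℕ, ((k : ℝ) + 1) * (((k + 1 : ℕ) + 1) * (((k + 1 + 1 : ℕ) + 1) *
    coeffSq (k + 1 + 1 + 1))) * t ^ k

theorem hasDerivAt_G (t : ℝ) : HasDerivAt G (G₁ t) t :=
  (powerSeries_hasDerivAt coeffSq summable_coeffSq).2 t

theorem summable_G₁ (t : ℝ) : Summable fun k : ℕ => ((k : ℝ) + 1) * coeffSq (k + 1) * t ^ k :=
  (powerSeries_hasDerivAt coeffSq summable_coeffSq).1 t

theorem hasDerivAt_G₁ (t : ℝ) : HasDerivAt G₁ (G₂ t) t :=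
  (powerSeries_hasDerivAt (fun k => ((k : ℝ) + 1) * coeffSq (k + 1)) summable_G₁).2 t

theorem summable_G₂ (t : ℝ) : Summable fun k : ℕ =>
    ((k : ℝ) + 1) * (((k + 1 : ℕ) + 1) * coeffSq (k + 1 + 1)) * t ^ k :=
  (powerSeries_hasDerivAt (fun k => ((k : ℝ) + 1) * coeffSq (k + 1)) summable_G₁).1 t

theorem hasDerivAt_G₂ (t : ℝ) : HasDerivAt G₂ (G₃ t) t :=
  (powerSeries_hasDerivAt
    (fun k => ((k : ℝ) + 1) * (((k + 1 : ℕ) + 1) * coeffSq (k + 1 + 1))) summable_G₂).2 t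

theorem summable_G₃ (t : ℝ) : Summable fun k : ℕ =>
    ((k : ℝ) + 1) * (((k + 1 : ℕ) + 1) * (((k + 1 + 1 : ℕ) + 1) *
      coeffSq (k + 1 + 1 + 1))) * t ^ k :=
  (powerSeries_hasDerivAt
    (fun k => ((k : ℝ) + 1) * (((k + 1 : ℕ) + 1) * coeffSq (k + 1 + 1))) summable_G₂).1 t

/-- The third-order hypergeometric equation satisfied by `G`. -/
theorem hypergeometric_ode (t : ℝ) :
    2 * G t - (5 + 4 * t) * G₁ t - 16 * t * G₂ t - 16 * t ^ 2 * G₃ t = 0 := by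
  have s0 : HasSum (fun k => coeffSq k * t ^ k) (G t) := (summable_coeffSq t).hasSum
  have s1 : HasSum (fun k : ℕ => ((k : ℝ) + 1) * coeffSq (k + 1) * t ^ k) (G₁ t) :=
    (summable_G₁ t).hasSum
  have s1' : HasSum (fun k : ℕ => (k : ℝ) * coeffSq k * t ^ k) (t * G₁ t) :=
    hasSum_mul_shift _ t (fun k => (k : ℝ) * coeffSq k) (by simp) (by intro k; push_cast; rfl)
      (summable_G₁ t)
  have s2 : HasSum (fun k : ℕ => (k : ℝ) * (k + 1) * coeffSq (k + 1) * t ^ k) (t * G₂ t) :=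
    hasSum_mul_shift _ t (fun k => (k : ℝ) * (k + 1) * coeffSq (k + 1)) (by simp)
      (by intro k; push_cast; ring) (summable_G₂ t)
  have s3 : HasSum (fun k : ℕ => (k : ℝ) * (k + 1) * (k + 2) * coeffSq (k + 2) * t ^ k)
      (t * G₃ t) :=
    hasSum_mul_shift _ t (fun k => (k : ℝ) * (k + 1) * (k + 2) * coeffSq (k + 2)) (by simp)
      (by intro k; push_cast; ring) (summable_G₃ t)
  have s3' : HasSum (fun k : ℕ => ((k : ℝ) - 1) * k * (k + 1) * coeffSq (k + 1) * t ^ k)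
      (t * (t * G₃ t)) := by
    rw [← s3.tsum_eq]
    exact hasSum_mul_shift _ t (fun k => ((k : ℝ) - 1) * k * (k + 1) * coeffSq (k + 1)) (by simp)
      (by intro k; push_cast; ring) s3.summable
  have hs := ((((s0.mul_left 2).sub (s1.mul_left 5)).sub (s1'.mul_left 4)).sub
    (s2.mul_left 16)).sub (s3'.mul_left 16)
  have hz : HasSum (fun _ : ℕ => (0 : ℝ)) (2 * G t - 5 * G₁ t - 4 * (t * G₁ t) -
      16 * (t * G₂ t) - 16 * (t * (t * G₃ t))) := by
    refine hs.congr_fun fun k => ?_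
    -- The `k`-th coefficient of the equation is `-2` times the recursion: `5 + 16k + 16k(k-1) =
    -- 4(4k² + 5/4)`.
    linear_combination (2 * t ^ k) * coeffSq_rec k
  have := hz.unique hasSum_zero
  linear_combination this

theorem G_zero : G 0 = 5 / 2 := by
  rw [G, tsum_eq_single 0 (fun k hk => by simp [hk])]
  simp [coeffSq]

theorem G₁_zero : G₁ 0 = 1 := by
  rw [G₁, tsum_eq_single 0 (fun k hk => by simp [hk])]
  simp [coeffSq, coeff]

/-- The quadratic first integral of the hypergeometric equation. -/
theorem first_integral (t : ℝ) :
    4 * G₁ t * (G t - t * G₁ t) = 16 * t ^ 2 * G₂ t ^ 2 + 5 * G₁ t ^ 2 + 5 := by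
  let E : ℝ → ℝ := fun s =>
    4 * G₁ s * (G s - s * G₁ s) - (16 * s ^ 2 * G₂ s ^ 2 + 5 * G₁ s ^ 2 + 5)
  have hE : ∀ s, HasDerivAt E 0 s := by
    intro s
    have g0 := hasDerivAt_G s
    have g1 := hasDerivAt_G₁ s
    have g2 := hasDerivAt_G₂ s
    have i := hasDerivAt_id s
    have := (((g1.const_mul 4).mul (g0.sub (i.mul g1)))).sub
      (((((i.pow 2).const_mul 16).mul (g2.pow 2)).add ((g1.pow 2).const_mul 5)).add_const 5)
    refine (this.congr_deriv ?_)
    simp only [id, Pi.mul_apply, Pi.sub_apply, Pi.pow_apply]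
    push_cast
    -- `E'` is `2 G''` times the left side of the equation.
    linear_combination (2 * G₂ s) * hypergeometric_ode s
  have hc := is_const_of_deriv_eq_zero (fun s => (hE s).differentiableAt) (fun s => (hE s).deriv) t 0
  simp only [E, G_zero, G₁_zero] at hc
  linarith

theorem continuous_G : Continuous G :=
  continuous_iff_continuousAt.2 fun t => (hasDerivAt_G t).continuousAt

theorem continuous_G₁ : Continuous G₁ :=
  continuous_iff_continuousAt.2 fun t => (hasDerivAt_G₁ t).continuousAt

theorem continuous_G₂ : Continuous G₂ :=
  continuous_iff_continuousAt.2 fun t => (hasDerivAt_G₂ t).continuousAt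

/-- At a zero of `G₁` the first integral would read `0 ≥ 5`, so `G₁` keeps the sign of `G₁ 0 = 1`.
-/
theorem G₁_pos {t : ℝ} (ht : 0 ≤ t) : 0 < G₁ t := by
  by_contra! hneg
  obtain ⟨s, -, hs⟩ := intermediate_value_Icc' ht continuous_G₁.continuousOn
    (show (0 : ℝ) ∈ Set.Icc (G₁ t) (G₁ 0) from ⟨hneg, by rw [G₁_zero]; norm_num⟩)
  have := first_integral s
  rw [hs] at this
  nlinarith [sq_nonneg (s * G₂ s)]

theorem X0_eq (x : ℝ) : X0 x = G (x ^ 2) := by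
  rw [G, (summable_coeffSq (x ^ 2)).tsum_eq_zero_add, X0]
  simp [coeffSq, pow_mul]

theorem hasDerivAt_X0 (x : ℝ) : HasDerivAt X0 (2 * x * G₁ (x ^ 2)) x := by
  have hX : X0 = fun x => G (x ^ 2) := funext X0_eq
  rw [hX]
  have := (hasDerivAt_G (x ^ 2)).comp x (hasDerivAt_pow 2 x)
  refine this.congr_deriv ?_
  push_cast; ring

theorem dX0_eq (x : ℝ) : dX0 x = 2 * x * G₁ (x ^ 2) := (hasDerivAt_X0 x).deriv

theorem ddX0_eq (x : ℝ) : ddX0 x = 2 * G₁ (x ^ 2) + 4 * x ^ 2 * G₂ (x ^ 2) := by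
  have hX : deriv X0 = fun x => 2 * x * G₁ (x ^ 2) := funext dX0_eq
  rw [ddX0, hX]
  have := ((hasDerivAt_id x).const_mul 2).mul
    ((hasDerivAt_G₁ (x ^ 2)).comp x (hasDerivAt_pow 2 x))
  refine (this.congr_deriv ?_).deriv
  simp only [id, Function.comp]
  push_cast; ring

/-! ### Extending `h` and the connection coefficients across `x = 0` -/

/-- The function `h` in terms of `G`; it extends across the line `x = 0`. -/
def hExt (p : ℝ × ℝ) : ℝ :=
  2 * G (p.1 ^ 2) - 2 * p.1 ^ 2 * G₁ (p.1 ^ 2) + 2 * p.2 ^ 2 * G₁ (p.1 ^ 2) + √5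

theorem dX0_div {x : ℝ} (hx : 0 < x) : dX0 x / x = 2 * G₁ (x ^ 2) := by
  rw [dX0_eq]; field_simp

theorem h_eq {p : ℝ × ℝ} (hp : 0 < p.1) : h p = hExt p := by
  rw [h, hExt, X0_eq, dX0_div hp, dX0_eq]; ring

theorem hExt_pos (p : ℝ × ℝ) : 0 < hExt p := by
  have h1 := G₁_pos (sq_nonneg p.1)
  have h2 : 0 < G (p.1 ^ 2) - p.1 ^ 2 * G₁ (p.1 ^ 2) := by
    have : 0 < 4 * G₁ (p.1 ^ 2) * (G (p.1 ^ 2) - p.1 ^ 2 * G₁ (p.1 ^ 2)) := by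
      rw [first_integral]; positivity
    exact pos_of_mul_pos_right this (by positivity)
  have h3 : 0 ≤ 2 * p.2 ^ 2 * G₁ (p.1 ^ 2) := by positivity
  have h4 : 0 < √5 := by positivity
  unfold hExt
  linarith

theorem continuous_hExt : Continuous hExt := by
  have := continuous_G
  have := continuous_G₁
  unfold hExt
  fun_prop

theorem a₂_eq {p : ℝ × ℝ} (hp : 0 < p.1) :
    a₂ p = -1 + 4 * p.2 ^ 2 * G₁ (p.1 ^ 2) / hExt p := by
  have hne := (hExt_pos p).ne'
  rw [a₂, h_eq hp, dX0_div hp, X0_eq]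
  field_simp
  unfold hExt
  ring

theorem b₂_eq {p : ℝ × ℝ} (hp : 0 < p.1) :
    b₂ p = -2 * p.2 * (G₁ (p.1 ^ 2) + √5) / hExt p := by
  have : dX0 p.1 / (2 * p.1) = G₁ (p.1 ^ 2) := by rw [dX0_eq]; field_simp
  rw [b₂, h_eq hp, this]
  ring

theorem c₂_eq {p : ℝ × ℝ} (hp : 0 < p.1) :
    c₂ p = 8 * p.2 * p.1 ^ 2 * G₂ (p.1 ^ 2) / hExt p := by
  rw [c₂, h_eq hp, dX0_div hp, ddX0_eq]
  ring

/-! ### The direction of `du/dy` -/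

/-- The coefficient of `X_β + y φ` in the direction of `du/dy`. -/
def dirK (p : ℝ × ℝ) : ℝ := -1 + 4 * (1 + p.2 ^ 2) * G₁ (p.1 ^ 2) / hExt p

/-- The coefficient of `ξ` in the direction of `du/dy`. -/
def dirB (p : ℝ × ℝ) : ℝ := 2 * (1 + p.2 ^ 2) * (G₁ (p.1 ^ 2) + √5) / hExt p

/-- The coefficient of `-X_α` in the direction of `du/dy`. -/
def dirC (p : ℝ × ℝ) : ℝ := 8 * (1 + p.2 ^ 2) * p.1 ^ 2 * G₂ (p.1 ^ 2) / hExt p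

theorem continuous_dirK : Continuous dirK := by
  have := continuous_G₁
  have := continuous_hExt
  have hne : ∀ p, hExt p ≠ 0 := fun p => (hExt_pos p).ne'
  unfold dirK
  fun_prop (disch := exact hne _)

theorem continuous_dirB : Continuous dirB := by
  have := continuous_G₁
  have := continuous_hExt
  have hne : ∀ p, hExt p ≠ 0 := fun p => (hExt_pos p).ne'
  unfold dirB
  fun_prop (disch := exact hne _)

theorem continuous_dirC : Continuous dirC := by
  have := continuous_G₂
  have := continuous_hExt
  have hne : ∀ p, hExt p ≠ 0 := fun p => (hExt_pos p).ne'
  unfold dirC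
  fun_prop (disch := exact hne _)

/-- The unit vector in the direction of `du/dy`. -/
def direction (F : Fin 4 → ℝ × ℝ → E4) (p : ℝ × ℝ) : E4 :=
  (√(1 + p.2 ^ 2))⁻¹ •
    ((p.2 * dirK p) • F 0 p + (-dirC p) • F 1 p + dirK p • F 2 p + dirB p • F 3 p)

/-- After clearing denominators this is the first integral multiplied by `4(1 + y²)²`; the terms
linear in `√5` cancel. -/
theorem dir_coeff_sq (p : ℝ × ℝ) :
    (p.2 * dirK p) ^ 2 + (-dirC p) ^ 2 + dirK p ^ 2 + dirB p ^ 2 = 1 + p.2 ^ 2 := by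
  have hne := (hExt_pos p).ne'
  have hI := first_integral (p.1 ^ 2)
  have h5 : √5 ^ 2 = 5 := Real.sq_sqrt (by norm_num)
  have hH : hExt p = 2 * G (p.1 ^ 2) - 2 * p.1 ^ 2 * G₁ (p.1 ^ 2) +
    2 * p.2 ^ 2 * G₁ (p.1 ^ 2) + √5 := rfl
  unfold dirK dirB dirC
  set H := hExt p
  field_simp
  rw [hH]
  linear_combination (-4 * (1 + p.2 ^ 2) ^ 2) * hI + 4 * (1 + p.2 ^ 2) ^ 2 * h5

/-! ### Derivatives of the axis vector -/

variable {F : Fin 4 → ℝ × ℝ → E4} {f : ℝ × ℝ → E4}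

theorem IsFrameField.norm_sq_comb (hF : IsFrameField F) {p : ℝ × ℝ} (hp : 0 < p.1)
    (a b c d : ℝ) :
    ‖a • F 0 p + b • F 1 p + c • F 2 p + d • F 3 p‖ ^ 2 = a ^ 2 + b ^ 2 + c ^ 2 + d ^ 2 := by
  have := (hF.orthonormal p hp).inner_sum ![a, b, c, d] ![a, b, c, d] Finset.univ
  rw [real_inner_self_eq_norm_sq] at this
  simpa [Fin.sum_univ_four, ← pow_two] using this

theorem norm_direction (hF : IsFrameField F) {p : ℝ × ℝ} (hp : 0 < p.1) :
    ‖direction F p‖ = 1 := by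
  have h0 : 0 < 1 + p.2 ^ 2 := by positivity
  have h1 : ‖direction F p‖ ^ 2 = 1 := by
    rw [direction, norm_smul, mul_pow, hF.norm_sq_comb hp, dir_coeff_sq, norm_inv,
      Real.norm_eq_abs, inv_pow, sq_abs, Real.sq_sqrt h0.le, inv_mul_cancel₀ h0.ne']
  nlinarith [norm_nonneg (direction F p)]

theorem hasDerivAt_snd_of_form {g : ℝ × ℝ → E4} {v w : E4} {x y : ℝ}
    (hg : HasFDerivAt g (form v w) (x, y)) : HasDerivAt (fun s => g (x, s)) w y := by
  have := hg.comp_hasDerivAt y ((hasDerivAt_const y x).prodMk (hasDerivAt_id y))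
  simpa [form, Function.comp_def] using this

theorem hasDerivAt_fst_of_form {g : ℝ × ℝ → E4} {v w : E4} {x y : ℝ}
    (hg : HasFDerivAt g (form v w) (x, y)) : HasDerivAt (fun s => g (s, y)) v x := by
  have := hg.comp_hasDerivAt x ((hasDerivAt_id x).prodMk (hasDerivAt_const x y))
  simpa [form, Function.comp_def] using this

/-- The factor `y²` appears because `1 + a₂`, `y b₂` and `y c₂` are all divisible by it; the
remaining `φ`-term `-y` is corrected to order `y³` by the derivative of the normalising factor. -/
theorem hasDerivAt_axisVector (hF : IsFrameField F) {x : ℝ} (hx : 0 < x) (y : ℝ) :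
    HasDerivAt (fun s => axisVector F (x, s)) ((y ^ 2 / (1 + y ^ 2)) • direction F (x, y)) y := by
  have h0 : 0 < 1 + y ^ 2 := by positivity
  have d0 := hasDerivAt_snd_of_form (hF.structure_eq (x, y) hx 0)
  have d2 := hasDerivAt_snd_of_form (hF.structure_eq (x, y) hx 2)
  simp [Fin.sum_univ_four, Ω₂] at d0 d2
  have ds := ((((hasDerivAt_pow 2 y).const_add 1).sqrt h0.ne').inv (Real.sqrt_pos.2 h0).ne')
  have hd := ds.smul (((hasDerivAt_id y).smul d2).sub d0)
  refine hd.congr_deriv ?_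
  have hs : √(1 + y ^ 2) ^ 2 = 1 + y ^ 2 := Real.sq_sqrt h0.le
  have hs0 : √(1 + y ^ 2) ≠ 0 := (Real.sqrt_pos.2 h0).ne'
  have hH := (hExt_pos (x, y)).ne'
  have hp : 0 < (x, y).1 := hx
  rw [a₂_eq hp, b₂_eq hp, c₂_eq hp, direction, dirK, dirB, dirC]
  simp only [id, Pi.inv_apply, Pi.smul_apply', Pi.sub_apply]
  rw [← hs, Real.sqrt_sq (Real.sqrt_nonneg _)]
  set s := √(1 + y ^ 2)
  match_scalars
  all_goals field_simp
  all_goals try push_cast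
  all_goals ring_nf
  linear_combination (-y * hExt (x, y)) * hs

/-- The `x`-derivatives of `φ` and `X_β` are multiples of `X_α`, and they cancel by `a₁ = -y c₁`. -/
theorem axisVector_fst_eq (hF : IsFrameField F) {x : ℝ} (hx : 0 < x) (y : ℝ) :
    axisVector F (x, y) = axisVector F (1, y) := by
  have hd : ∀ x > 0, HasDerivAt (fun s => axisVector F (s, y)) 0 x := by
    intro x hx
    have d0 := hasDerivAt_fst_of_form (hF.structure_eq (x, y) hx 0)
    have d2 := hasDerivAt_fst_of_form (hF.structure_eq (x, y) hx 2)
    simp [Fin.sum_univ_four, Ω₁] at d0 d2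
    refine (((d2.const_smul y).sub d0).const_smul (√(1 + y ^ 2))⁻¹).congr_deriv ?_
    have : a₁ (x, y) = -y * c₁ (x, y) := by unfold a₁ c₁; ring
    rw [this]
    module
  exact (convex_Ioi (0 : ℝ)).is_const_of_fderivWithin_eq_zero (𝕜 := ℝ)
    (f := fun s => axisVector F (s, y))
    (fun s hs => (hd s hs).differentiableAt.differentiableWithinAt)
    (fun s hs => by
      rw [((hd s hs).hasFDerivAt.hasFDerivWithinAt).fderivWithin
        (isOpen_Ioi.uniqueDiffWithinAt hs)]
      ext; simp) hx (show (0 : ℝ) < 1 by norm_num)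

/-! ### Spheres containing the `x`-curves -/

/-- The point of an `x`-curve relative to the centre of the sphere containing it. -/
def radial (F : Fin 4 → ℝ × ℝ → E4) (p : ℝ × ℝ) : E4 :=
  (2 * √5 * (1 + p.2 ^ 2))⁻¹ • (p.2 • F 0 p + (0 : ℝ) • F 1 p + (1 : ℝ) • F 2 p +
    (-(2 * (1 + p.2 ^ 2))) • F 3 p)

theorem radius_smul_sphereVector (p : ℝ × ℝ) :
    sphereRadius p.2 • sphereVector F p = radial F p := by
  have h0 : 0 < 1 + p.2 ^ 2 := by positivity
  have h1 : 0 < 5 + 4 * p.2 ^ 2 := by positivity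
  have hc : sphereRadius p.2 * (√((1 + p.2 ^ 2) * (5 + 4 * p.2 ^ 2)))⁻¹ =
      (2 * √5 * (1 + p.2 ^ 2))⁻¹ := by
    rw [sphereRadius, Real.sqrt_div h1.le, Real.sqrt_mul h0.le]
    have hs : √(1 + p.2 ^ 2) ^ 2 = 1 + p.2 ^ 2 := Real.sq_sqrt h0.le
    have hs0 := (Real.sqrt_pos.2 h0).ne'
    have hs1 := (Real.sqrt_pos.2 h1).ne'
    rw [show (2 * √5 * (1 + p.2 ^ 2))⁻¹ = (2 * √5 * √(1 + p.2 ^ 2) ^ 2)⁻¹ by rw [hs]]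
    field_simp
  rw [sphereVector, smul_smul, hc, radial]
  congr 1
  module

/-- In `-y a₁ + c₁ - 2(1 + y²) b₁` the terms in `X₀ + √5/2` cancel, leaving `2√5(1 + y²)(x² - y²)/(x
h)`; the normalisation of `radial` turns this into the `dx`-coefficient of `df`. -/
theorem sub_radial_fst_eq (hf : IsCurvatureSurface F f) {x : ℝ} (hx : 0 < x) (y : ℝ) :
    f (x, y) - radial F (x, y) = f (1, y) - radial F (1, y) := by
  have hd : ∀ x > 0, HasDerivAt (fun s => f (s, y) - radial F (s, y)) 0 x := by
    intro x hx
    have d := hasDerivAt_fst_of_form (hf.integral (x, y) hx)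
    have d0 := hasDerivAt_fst_of_form (hf.frame.structure_eq (x, y) hx 0)
    have d1 := hasDerivAt_fst_of_form (hf.frame.structure_eq (x, y) hx 1)
    have d2 := hasDerivAt_fst_of_form (hf.frame.structure_eq (x, y) hx 2)
    have d3 := hasDerivAt_fst_of_form (hf.frame.structure_eq (x, y) hx 3)
    refine (d.sub (((((d0.const_smul y).add (d1.const_smul (0 : ℝ))).add
      (d2.const_smul (1 : ℝ))).add (d3.const_smul (-(2 * (1 + y ^ 2))))).const_smul
      (2 * √5 * (1 + y ^ 2))⁻¹)).congr_deriv ?_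
    have hne : h (x, y) ≠ 0 := by
      rw [h_eq (p := (x, y)) hx]; exact (hExt_pos _).ne'
    have h5 : √5 ^ 2 = 5 := Real.sq_sqrt (by norm_num)
    have h50 : √5 ≠ 0 := by positivity
    have h0 : 1 + y ^ 2 ≠ 0 := by positivity
    simp only [Fin.sum_univ_four, Ω₁, Matrix.of_apply, Matrix.cons_val, zero_smul, zero_add,
      add_zero]
    unfold a₁ b₁ c₁
    match_scalars
    field_simp
    ring
  exact (convex_Ioi (0 : ℝ)).is_const_of_fderivWithin_eq_zero (𝕜 := ℝ)
    (f := fun s => f (s, y) - radial F (s, y))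
    (fun s hs => (hd s hs).differentiableAt.differentiableWithinAt)
    (fun s hs => by
      rw [((hd s hs).hasFDerivAt.hasFDerivWithinAt).fderivWithin
        (isOpen_Ioi.uniqueDiffWithinAt hs)]
      ext; simp) hx (show (0 : ℝ) < 1 by norm_num)

/-! ### Regularity in `y` -/

theorem analyticOnNhd_slice {g : ℝ × ℝ → E4} (hg : AnalyticOnNhd ℝ g D) :
    AnalyticOnNhd ℝ (fun y => g (1, y)) Set.univ := fun y _ =>
  (hg (1, y) (show (0 : ℝ) < 1 by norm_num)).comp₂ analyticAt_const analyticAt_id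

theorem analyticOnNhd_axisVector (hF : IsFrameField F) :
    AnalyticOnNhd ℝ (fun y => axisVector F (1, y)) Set.univ := by
  intro y hy
  have h0 : 0 < 1 + y ^ 2 := by positivity
  have f0 := analyticOnNhd_slice (hF.analytic 0) y hy
  have f2 := analyticOnNhd_slice (hF.analytic 2) y hy
  have hs : AnalyticAt ℝ (fun y : ℝ => √(1 + y ^ 2)) y := by
    have : ContDiffAt ℝ ⊤ (fun y : ℝ => √(1 + y ^ 2)) y :=
      (contDiffAt_const.add (contDiffAt_id.pow 2)).sqrt h0.ne'
    exact this.analyticAt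
  exact (hs.inv (Real.sqrt_pos.2 h0).ne').smul ((analyticAt_id.smul f2).sub f0)

theorem analyticOnNhd_radial (hF : IsFrameField F) :
    AnalyticOnNhd ℝ (fun y => radial F (1, y)) Set.univ := by
  intro y hy
  have h0 : 2 * √5 * (1 + y ^ 2) ≠ 0 := by positivity
  have f0 := analyticOnNhd_slice (hF.analytic 0) y hy
  have f2 := analyticOnNhd_slice (hF.analytic 2) y hy
  have f3 := analyticOnNhd_slice (hF.analytic 3) y hy
  have hy2 : AnalyticAt ℝ (fun y : ℝ => 1 + y ^ 2) y := analyticAt_const.add (analyticAt_id.pow 2)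
  have k : AnalyticAt ℝ (fun y : ℝ => (2 * √5 * (1 + y ^ 2))⁻¹) y :=
    (analyticAt_const.mul hy2).inv h0
  have t0 : AnalyticAt ℝ (fun y : ℝ => y • F 0 (1, y)) y := analyticAt_id.smul f0
  have t1 : AnalyticAt ℝ (fun y : ℝ => (0 : ℝ) • F 1 (1, y)) y := by
    simpa only [zero_smul] using analyticAt_const
  have t2 : AnalyticAt ℝ (fun y : ℝ => (1 : ℝ) • F 2 (1, y)) y := by
    simpa only [one_smul] using f2
  have c3 : AnalyticAt ℝ (fun y : ℝ => -(2 * (1 + y ^ 2))) y := (analyticAt_const.mul hy2).neg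
  have t3 : AnalyticAt ℝ (fun y : ℝ => (-(2 * (1 + y ^ 2))) • F 3 (1, y)) y := c3.smul f3
  exact k.smul (((t0.add t1).add t2).add t3)

theorem continuous_direction (hF : IsFrameField F) {x : ℝ} (hx : 0 < x) :
    Continuous fun y => direction F (x, y) := by
  have hc : ∀ j, Continuous fun y => F j (x, y) := fun j =>
    continuous_iff_continuousAt.2 fun y =>
      (hasDerivAt_snd_of_form (hF.structure_eq (x, y) hx j)).continuousAt
  have hx' : Continuous fun y : ℝ => (x, y) := by fun_prop
  have hK := continuous_dirK.comp hx'
  have hB := continuous_dirB.comp hx'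
  have hC := continuous_dirC.comp hx'
  have hs : Continuous fun y : ℝ => √(1 + y ^ 2) := by fun_prop
  exact (hs.inv₀ fun y => by positivity).smul
    (((((continuous_id.mul hK).smul (hc 0)).add (hC.neg.smul (hc 1))).add
      (hK.smul (hc 2))).add (hB.smul (hc 3)))

/-! ### Existence and uniqueness of `u`, `v₁`, `A` -/

/-- The function `v₁` of any associated triple is the direction computed at any `x > 0`. -/
theorem IsAssociated.v₁_eq (hF : IsFrameField F) {u v₁ A : ℝ → E4}
    (hA : IsAssociated F f u v₁ A) {x : ℝ} (hx : 0 < x) (y : ℝ) :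
    v₁ y = direction F (x, y) := by
  -- The weight `y²/(1 + y²)` can be divided out only for `y ≠ 0`; continuity and density supply `y
  -- = 0`.
  have hEq : Set.EqOn v₁ (fun y => direction F (x, y)) {0}ᶜ := by
    intro z hz
    have hz' : z ≠ 0 := hz
    have hu : u = fun s => axisVector F (x, s) := funext fun s => hA.u_eq x s hx
    have h1 := hA.u_deriv z
    rw [hu] at h1
    have h2 := h1.unique (hasDerivAt_axisVector hF hx z)
    exact smul_right_injective E4 (by positivity : z ^ 2 / (1 + z ^ 2) ≠ 0) h2
  exact congrFun (hA.v₁_continuous.ext_on (dense_compl_singleton (0 : ℝ))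
    (continuous_direction hF hx) hEq) y

theorem isAssociated_exists (hf : IsCurvatureSurface F f) :
    IsAssociated F f (fun y => axisVector F (1, y)) (fun y => direction F (1, y))
      (fun y => f (1, y) - radial F (1, y)) where
  u_eq x y hx := (axisVector_fst_eq hf.frame hx y).symm
  u_analytic := analyticOnNhd_axisVector hf.frame
  v₁_unit y := norm_direction hf.frame (show (0 : ℝ) < 1 by norm_num)
  v₁_continuous := continuous_direction hf.frame one_pos
  u_deriv y := hasDerivAt_axisVector hf.frame one_pos y
  surface_eq x y hx := by
    rw [radius_smul_sphereVector (x, y), ← sub_radial_fst_eq hf hx y]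
    abel
  A_analytic := (analyticOnNhd_slice hf.analytic).sub (analyticOnNhd_radial hf.frame)

theorem IsAssociated.unique (hf : IsCurvatureSurface F f) {u v₁ A u' v₁' A' : ℝ → E4}
    (h : IsAssociated F f u v₁ A) (h' : IsAssociated F f u' v₁' A') :
    u = u' ∧ v₁ = v₁' ∧ A = A' := by
  refine ⟨funext fun y => ?_, funext fun y => ?_, funext fun y => ?_⟩
  · rw [h.u_eq 1 y one_pos, h'.u_eq 1 y one_pos]
  · rw [h.v₁_eq hf.frame one_pos, h'.v₁_eq hf.frame one_pos]
  · exact add_left_cancel ((h.surface_eq 1 y one_pos).symm.trans (h'.surface_eq 1 y one_pos))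

/-! ### The limit at the corner -/

theorem IsFrameField.norm_comb_le (hF : IsFrameField F) {p : ℝ × ℝ} (hp : 0 < p.1)
    (a b c d : ℝ) :
    ‖a • F 0 p + b • F 1 p + c • F 2 p + d • F 3 p‖ ≤ |a| + |b| + |c| + |d| := by
  have hn : ∀ (j : Fin 4) (t : ℝ), ‖t • F j p‖ ≤ |t| := fun j t => by
    rw [norm_smul, (hF.orthonormal p hp).1 j, mul_one, Real.norm_eq_abs]
  exact (norm_add_le _ _).trans (add_le_add ((norm_add_le _ _).trans (add_le_add
    ((norm_add_le _ _).trans (add_le_add (hn 0 a) (hn 1 b))) (hn 2 c))) (hn 3 d))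

theorem hExt_zero : hExt (0, 0) = 5 + √5 := by
  norm_num [hExt, G_zero]

theorem dirK_zero : dirK (0, 0) = -(√5)⁻¹ := by
  have h5 : √5 ^ 2 = 5 := Real.sq_sqrt (by norm_num)
  have h50 : 0 < √5 := by positivity
  rw [dirK, hExt_zero]
  simp only [ne_eq, OfNat.ofNat_ne_zero, not_false_eq_true, zero_pow, G₁_zero]
  field_simp
  linear_combination (-1) * h5

theorem dirB_zero : dirB (0, 0) = 2 * (√5)⁻¹ := by
  have h5 : √5 ^ 2 = 5 := Real.sq_sqrt (by norm_num)
  have h50 : 0 < √5 := by positivity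
  rw [dirB, hExt_zero]
  simp only [ne_eq, OfNat.ofNat_ne_zero, not_false_eq_true, zero_pow, G₁_zero]
  field_simp
  linear_combination h5

theorem dirC_zero : dirC (0, 0) = 0 := by simp [dirC]

/-- Near the corner `(0, 0)` the radial vector is `-1/2` times the direction of `du/dy`. -/
theorem tendsto_radial_add_direction (hF : IsFrameField F) :
    Tendsto (fun p => radial F p + (1 / 2 : ℝ) • direction F p) (𝓝[D] (0, 0)) (𝓝 0) := by
  let r : ℝ × ℝ → ℝ := fun p => (2 * √5 * (1 + p.2 ^ 2))⁻¹
  let s : ℝ × ℝ → ℝ := fun p => (√(1 + p.2 ^ 2))⁻¹ / 2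
  -- `B` sums the absolute values of the frame coefficients. It bounds the norm without any limit of
  -- the frame and is continuous on the whole plane.
  let B : ℝ × ℝ → ℝ := fun p =>
    |r p * p.2 + s p * (p.2 * dirK p)| + |s p * -dirC p| + |r p + s p * dirK p| +
      |r p * -(2 * (1 + p.2 ^ 2)) + s p * dirB p|
  have hB : Continuous B := by
    have := continuous_dirK
    have := continuous_dirB
    have := continuous_dirC
    have h1 : ∀ p : ℝ × ℝ, √(1 + p.2 ^ 2) ≠ 0 := fun p => by positivity
    have h2 : ∀ p : ℝ × ℝ, 2 * √5 * (1 + p.2 ^ 2) ≠ 0 := fun p => by positivity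
    have hr : Continuous r := by unfold r; fun_prop (disch := exact h2 _)
    have hs : Continuous s := by unfold s; fun_prop (disch := exact h1 _)
    unfold B
    fun_prop
  have hB0 : B (0, 0) = 0 := by
    simp only [B, r, s, dirK_zero, dirB_zero, dirC_zero]
    norm_num
    ring_nf
    simp
  refine squeeze_zero_norm' (a := B) ?_ ?_
  · filter_upwards [self_mem_nhdsWithin] with p hp
    have : radial F p + (1 / 2 : ℝ) • direction F p =
        (r p * p.2 + s p * (p.2 * dirK p)) • F 0 p + (s p * -dirC p) • F 1 p +
          (r p + s p * dirK p) • F 2 p +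
          (r p * -(2 * (1 + p.2 ^ 2)) + s p * dirB p) • F 3 p := by
      simp only [radial, direction, r, s]
      module
    rw [this]
    exact hF.norm_comb_le hp _ _ _ _
  · have := hB.tendsto (0, 0)
    rw [hB0] at this
    exact this.mono_left nhdsWithin_le_nhds

/-- On `D`, `f` equals `(radial + v₁(y)/2) + (-v₁(y)/2 + A(y))`: the first bracket vanishes in the
limit, and the second is continuous in `y` alone. -/
theorem tendsto_corner (hf : IsCurvatureSurface F f) {u v₁ A : ℝ → E4}
    (hA : IsAssociated F f u v₁ A) :
    Tendsto f (𝓝[D] (0, 0)) (𝓝 (-(1 / 2 : ℝ) • v₁ 0 + A 0)) := by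
  have hc : Continuous fun p : ℝ × ℝ => -(1 / 2 : ℝ) • v₁ p.2 + A p.2 := by
    have h1 := hA.v₁_continuous
    have h2 : Continuous A := continuousOn_univ.1 hA.A_analytic.continuousOn
    fun_prop
  have ht := (tendsto_radial_add_direction hf.frame).add
    ((hc.tendsto (0, 0)).mono_left (nhdsWithin_le_nhds (s := D)))
  rw [zero_add] at ht
  refine ht.congr' ?_
  filter_upwards [self_mem_nhdsWithin] with p hp
  have h1 := hA.surface_eq p.1 p.2 hp
  rw [radius_smul_sphereVector (p.1, p.2)] at h1
  rw [h1, hA.v₁_eq hf.frame hp]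
  module

end CurvatureSurface

end

theorem mainTheorem10 (F : Fin 4 → ℝ × ℝ → CurvatureSurface.E4)
    (f : ℝ × ℝ → CurvatureSurface.E4) (hf : CurvatureSurface.IsCurvatureSurface F f) :
    (∃! t : (ℝ → CurvatureSurface.E4) × (ℝ → CurvatureSurface.E4) × (ℝ → CurvatureSurface.E4),
      CurvatureSurface.IsAssociated F f t.1 t.2.1 t.2.2) ∧
    ∀ u v₁ A : ℝ → CurvatureSurface.E4, CurvatureSurface.IsAssociated F f u v₁ A →
      (∀ p : ℕ → ℝ × ℝ, (∀ n, p n ∈ CurvatureSurface.D) →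
        Filter.Tendsto p Filter.atTop (nhds (0, 0)) →
        Filter.Tendsto (fun n => f (p n)) Filter.atTop (nhds (-(1 / 2 : ℝ) • v₁ 0 + A 0))) ∧
      ContinuousOn (Function.update f (0, 0) (-(1 / 2 : ℝ) • v₁ 0 + A 0))
        (CurvatureSurface.D ∪ {(0, 0)}) := by
  refine ⟨⟨⟨_, _, _⟩, CurvatureSurface.isAssociated_exists hf, ?_⟩, ?_⟩
  · rintro ⟨u, v₁, A⟩ h
    obtain ⟨rfl, rfl, rfl⟩ := h.unique hf (CurvatureSurface.isAssociated_exists hf)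
    rfl
  · intro u v₁ A hA
    have hlim := CurvatureSurface.tendsto_corner hf hA
    have h0 : ((0, 0) : ℝ × ℝ) ∉ CurvatureSurface.D := fun hmem => lt_irrefl (0 : ℝ) hmem
    refine ⟨fun p hp hp0 => hlim.comp (tendsto_nhdsWithin_iff.2 ⟨hp0, .of_forall hp⟩), ?_⟩
    have hD : (CurvatureSurface.D ∪ {(0, 0)}) \ {(0, 0)} = CurvatureSurface.D := by
      rw [Set.union_sdiff_right, Set.sdiff_singleton_eq_self h0]
    rw [continuousOn_update_iff, hD]
    exact ⟨hf.analytic.continuousOn, fun _ => hlim⟩
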